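/- A finite simple graph $G$ of order $n$ is called edge-pancyclic if for every integer $k$ with $3\le k\le n$, every edge of $G$ lies in a cycle of length $k$. Let $n\ge 3$ be an integer. Then the maximum diameter of an edge-pancyclic graph of order $n$ with at least one edge is $\lfloor 2n/5\rfloor$: every such graph is connected and has diameter at most $\lfloor 2n/5\rfloor$, and some such graph has diameter exactly $\lfloor 2n/5\rfloor$. -/

import Mathlib

/-- A finite simple graph `G` of order `n` is edge-pancyclic if, for every integer `k` with
`3 ≤ k ≤ n`, every edge of `G` lies in a cycle of length `k`. -/
def EdgePancyclic {V : Type*} [Fintype V] (G : SimpleGraph V) : Prop :=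
  ∀ k : ℕ, 3 ≤ k → k ≤ Fintype.card V → ∀ e ∈ G.edgeSet,
    ∃ (v : V) (c : G.Walk v v), c.IsCycle ∧ c.length = k ∧ e ∈ c.edges

/-! Upper bound. An edge lies on a Hamiltonian cycle, so the graph is connected and a cyclic
successor map is available. Take `y` farthest from `x`, at distance `D ≥ 2`, and sort the vertices
by distance from `x`. By `EdgePancyclic.card_boundary`, an inner level has at least two vertices,
and at least three if it contains an edge. An edge between consecutive levels lies in a triangle,
whose third vertex puts an edge inside one of the two levels; hence two consecutive inner levels
have at least `3 + 2` vertices. Endpoint degrees are at least three, and summing over consecutive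
levels gives `5 * D ≤ 2 * n`.

Lower bound. Level sizes 1, 3, 2, 3, 2, ..., 3, 1 are realised by gluing blocks at their ends: the
ends `d` and `e` become nonadjacent twins, and cycles through `d` and through `e` merge with their
lengths added (`EdgeCycle.glue`). Gluing on the five-vertex block adds 5 to the order and 2 to the
distance. The induction starts from blocks of orders 4 to 8, checked by computation. -/

/-! ### Upper bound on the diameter. -/

open Function in
theorem EdgePancyclic.exists_successor {V : Type*} [Fintype V] {G : SimpleGraph V}
    (hG : EdgePancyclic G) (hn : 3 ≤ Fintype.card V) {a b : V} (hab : G.Adj a b) :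
    ∃ σ : V → V, Injective σ ∧ (∀ v, G.Adj v (σ v)) ∧
      (∀ T : Set V, T.Nonempty → (∀ v ∈ T, σ v ∈ T) → T = Set.univ) ∧
      (σ a = b ∨ σ b = a) := by
  classical
  obtain ⟨w, c, hc, hlen, he⟩ := hG _ hn le_rfl s(a, b) hab
  have hham := SimpleGraph.Walk.isHamiltonianCycle_iff_isCycle_and_length_eq.2 ⟨hc, hlen⟩
  have hex : ∀ v, ∃ i, i < c.length ∧ c.getVert i = v := by
    intro v
    obtain ⟨i, hi, hile⟩ := SimpleGraph.Walk.mem_support_iff_exists_getVert.1 (hham.mem_support v)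
    rcases hile.lt_or_eq with h | h
    · exact ⟨i, h, hi⟩
    -- The closing vertex of the walk is its initial one, so it receives index 0.
    · refine ⟨0, by lia, ?_⟩
      rw [← hi, h]; simp
  choose idx hidx hget using hex
  have hidx' : ∀ i < c.length, idx (c.getVert i) = i := fun i hi ↦
    hc.getVert_injOn' (by have := hidx (c.getVert i); simp only [Set.mem_ofPred_eq]; lia)
      (by simp only [Set.mem_ofPred_eq]; lia) (hget _)
  have hσ : ∀ i < c.length, c.getVert (idx (c.getVert i) + 1) = c.getVert (i + 1) := by
    intro i hi; rw [hidx' i hi]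
  refine ⟨fun v ↦ c.getVert (idx v + 1), ?_, ?_, ?_, ?_⟩
  · intro v w h
    have := hc.getVert_injOn (by have := hidx v; simp only [Set.mem_ofPred_eq]; lia)
      (by have := hidx w; simp only [Set.mem_ofPred_eq]; lia) h
    rw [← hget v, ← hget w, Nat.succ_injective this]
  · intro v
    have := c.adj_getVert_succ (hidx v)
    rwa [hget] at this
  · rintro T ⟨t, ht⟩ hT
    have step : ∀ i j, i + j ≤ c.length → c.getVert i ∈ T → c.getVert (i + j) ∈ T := by
      intro i j
      induction j with
      | zero => simp
      | succ j ih =>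
        intro hij hi
        have := hT _ (ih (by lia) hi)
        simp only [hσ (i + j) (by lia)] at this
        exact this
    -- Moving forward from `t` reaches the last vertex, which is also the first, and from there
    -- every vertex.
    have hlast : c.getVert c.length ∈ T := by
      have := step (idx t) (c.length - idx t) (by have := hidx t; lia) (by rwa [hget])
      rwa [Nat.add_sub_cancel' (hidx t).le] at this
    have hzero : c.getVert 0 ∈ T := by simpa using hlast
    refine Set.eq_univ_of_forall fun v ↦ ?_
    have := step 0 (idx v) (by have := hidx v; lia) hzero
    rwa [zero_add, hget] at this
  · rw [← SimpleGraph.Walk.mem_edges_toSubgraph, SimpleGraph.Subgraph.mem_edgeSet,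
      SimpleGraph.Walk.toSubgraph_adj_iff] at he
    obtain ⟨i, hi, hil⟩ := he
    rcases Sym2.eq_iff.1 hi with ⟨rfl, rfl⟩ | ⟨rfl, rfl⟩
    · exact Or.inl (hσ i hil)
    · exact Or.inr (hσ i hil)

/-- In a graph whose edges all lie on Hamiltonian cycles, the inner boundary `P` of a set `S` of
vertices has at least two elements, and at least three if some edge joins two elements of `P`. -/
theorem EdgePancyclic.card_boundary {V : Type*} [Fintype V] {G : SimpleGraph V}
    (hG : EdgePancyclic G) (hn : 3 ≤ Fintype.card V) {a b : V} (hab : G.Adj a b)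
    {S : Set V} {P : Finset V} (hPS : ∀ u ∈ P, u ∈ S)
    (hP : ∀ u ∈ S, ∀ v ∉ S, G.Adj u v → u ∈ P)
    {s t : V} (hs : s ∈ S) (hsP : s ∉ P) (ht : t ∉ S) :
    2 ≤ P.card ∧ (a ∈ P → b ∈ P → 3 ≤ P.card) := by
  obtain ⟨σ, hinj, hadj, hclosed, hedge⟩ := hG.exists_successor hn hab
  have key : ∀ T : Set V, T.Nonempty → T ≠ Set.univ → ∃ v ∈ T, σ v ∉ T := by
    intro T hT hne
    by_contra! h
    exact hne (hclosed T hT h)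
  -- The cycle must leave the interior of `S`, and can only do so into `P`.
  obtain ⟨v, ⟨hvS, hvP⟩, hv⟩ := key {v | v ∈ S ∧ v ∉ P} ⟨s, hs, hsP⟩
    (fun h ↦ ht (h.symm ▸ Set.mem_univ t : t ∈ {v | v ∈ S ∧ v ∉ P}).1)
  have hσvS : σ v ∈ S := by
    by_contra h
    exact hvP (hP _ hvS _ h (hadj v))
  have hσvP : σ v ∈ P := by
    by_contra h
    exact hv ⟨hσvS, h⟩
  -- It must also enter `S` from outside, again at a vertex of `P`.
  obtain ⟨w, hwS, hw⟩ := key Sᶜ ⟨t, ht⟩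
    (fun h ↦ (h.symm ▸ Set.mem_univ s : s ∈ Sᶜ) hs)
  have hσwS : σ w ∈ S := not_not.1 hw
  have hσwP : σ w ∈ P := hP _ hσwS _ hwS (hadj w).symm
  have hvw : σ v ≠ σ w := fun h ↦ hwS (hinj h ▸ hvS)
  refine ⟨Finset.one_lt_card.2 ⟨_, hσvP, _, hσwP, hvw⟩, fun ha hb ↦ ?_⟩
  -- The predecessors `v`, `w`, `z` lie in the interior, outside `S` and in `P`; injectivity of `σ`
  -- separates their successors.
  have three : ∀ z ∈ P, σ z ∈ P → 3 ≤ P.card := by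
    intro z hz hσz
    refine Finset.two_lt_card.2 ⟨_, hσvP, _, hσwP, _, hσz, hvw, ?_, ?_⟩
    · exact fun h ↦ hvP (hinj h ▸ hz)
    · exact fun h ↦ hwS (hinj h ▸ hPS z hz)
  rcases hedge with rfl | rfl
  · exact three a ha hb
  · exact three b hb ha

theorem EdgePancyclic.exists_common_neighbor {V : Type*} [Fintype V] {G : SimpleGraph V}
    (hG : EdgePancyclic G) (hn : 3 ≤ Fintype.card V) {a b : V} (hab : G.Adj a b) :
    ∃ z, G.Adj a z ∧ G.Adj b z := by
  obtain ⟨w, c, -, hlen, he⟩ := hG 3 le_rfl hn s(a, b) hab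
  rw [← SimpleGraph.Walk.mem_edges_toSubgraph, SimpleGraph.Subgraph.mem_edgeSet,
    SimpleGraph.Walk.toSubgraph_adj_iff] at he
  obtain ⟨i, hi, hil⟩ := he
  have h01 : G.Adj (c.getVert 0) (c.getVert 1) := c.adj_getVert_succ (by lia)
  have h12 : G.Adj (c.getVert 1) (c.getVert 2) := c.adj_getVert_succ (by lia)
  have h23 : G.Adj (c.getVert 2) (c.getVert 3) := c.adj_getVert_succ (by lia)
  have h30 : c.getVert 3 = c.getVert 0 := by simp [← hlen]
  rw [h30] at h23
  suffices ∃ z, G.Adj (c.getVert i) z ∧ G.Adj (c.getVert (i + 1)) z by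
    obtain ⟨z, h₁, h₂⟩ := this
    rcases Sym2.eq_iff.1 hi with ⟨rfl, rfl⟩ | ⟨rfl, rfl⟩
    · exact ⟨z, h₁, h₂⟩
    · exact ⟨z, h₂, h₁⟩
  rw [hlen] at hil
  interval_cases i
  · exact ⟨_, h23.symm, h12⟩
  · exact ⟨_, h01.symm, h23⟩
  · exact ⟨_, h12.symm, by rw [h30]; exact h01⟩

theorem EdgePancyclic.connected {V : Type*} [Fintype V] {G : SimpleGraph V}
    (hG : EdgePancyclic G) (hn : 3 ≤ Fintype.card V) {a b : V} (hab : G.Adj a b) :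
    G.Connected := by
  classical
  obtain ⟨w, c, hc, hlen, -⟩ := hG _ hn le_rfl s(a, b) hab
  exact SimpleGraph.IsHamiltonian.connected fun _ ↦
    ⟨w, c, SimpleGraph.Walk.isHamiltonianCycle_iff_isCycle_and_length_eq.2 ⟨hc, hlen⟩⟩

/-- A vertex with a non-neighbour has degree at least three. -/
theorem EdgePancyclic.three_le_card_neighbors {V : Type*} [Fintype V] {G : SimpleGraph V}
    (hG : EdgePancyclic G) (hn : 3 ≤ Fintype.card V) {x y : V} {N : Finset V}
    (hN : ∀ v, v ∈ N ↔ G.Adj x v) (hne : N.Nonempty) (hxy : y ≠ x) (hnadj : ¬ G.Adj x y) :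
    3 ≤ N.card := by
  obtain ⟨a, ha⟩ := hne
  rw [hN] at ha
  obtain ⟨b, hxb, hab⟩ := hG.exists_common_neighbor hn ha
  -- The inner boundary of the closed neighbourhood of `x` lies in `N`, and a triangle at `x`
  -- supplies an edge inside `N`.
  refine (hG.card_boundary hn hab (S := {v | v = x ∨ G.Adj x v}) (s := x) (t := y) ?_ ?_ ?_ ?_
    ?_).2 ((hN a).2 ha) ((hN b).2 hxb)
  · exact fun u hu ↦ Or.inr ((hN u).1 hu)
  · rintro u (rfl | hu) v hv huv
    · exact absurd (Or.inr huv) hv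
    · exact (hN u).2 hu
  · exact Or.inl rfl
  · simp [hN]
  · rintro (h | h)
    exacts [hxy h, hnadj h]

/-- Two consecutive inner distance levels together have at least five vertices. -/
theorem EdgePancyclic.five_le_card_levels {V : Type*} [Fintype V] {G : SimpleGraph V}
    (hG : EdgePancyclic G) (hn : 3 ≤ Fintype.card V) (hconn : G.Connected) {x y : V} {i : ℕ}
    (hi : 0 < i) (hy : i + 1 < G.dist x y) {P Q : Finset V}
    (hP : ∀ v, v ∈ P ↔ G.dist x v = i) (hQ : ∀ v, v ∈ Q ↔ G.dist x v = i + 1) :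
    5 ≤ P.card + Q.card := by
  have hlip : ∀ u v, G.Adj u v → G.dist x v ≤ G.dist x u + 1 := by
    intro u v huv
    have := hconn.dist_triangle (u := x) (v := u) (w := v)
    rwa [SimpleGraph.dist_eq_one_iff_adj.2 huv] at this
  have hPb : ∀ a b, G.Adj a b → 2 ≤ P.card ∧ (a ∈ P → b ∈ P → 3 ≤ P.card) := by
    intro a b hab
    refine hG.card_boundary hn hab (S := {v | G.dist x v ≤ i}) (s := x) (t := y) ?_ ?_ ?_ ?_ ?_
    · exact fun u hu ↦ ((hP u).1 hu).le
    · intro u hu v hv huv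
      have := hlip u v huv
      simp only [Set.mem_ofPred_eq] at hu hv
      rw [hP]; lia
    · simp
    · simp [hP]; lia
    · simp only [Set.mem_ofPred_eq]; lia
  have hQb : ∀ a b, G.Adj a b → 2 ≤ Q.card ∧ (a ∈ Q → b ∈ Q → 3 ≤ Q.card) := by
    intro a b hab
    refine hG.card_boundary hn hab (S := {v | i + 1 ≤ G.dist x v}) (s := y) (t := x) ?_ ?_ ?_ ?_ ?_
    · exact fun u hu ↦ ((hQ u).1 hu).ge
    · intro u hu v hv huv
      have := hlip v u huv.symm
      simp only [Set.mem_ofPred_eq] at hu hv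
      rw [hQ]; lia
    · simp only [Set.mem_ofPred_eq]; lia
    · simp [hQ]; lia
    · simp
  obtain ⟨p, hp, q, hq, hpq⟩ : ∃ p ∈ P, ∃ q ∈ Q, G.Adj p q := by
    obtain ⟨w, hw⟩ := hconn.exists_walk_length_eq_dist x y
    have hd : ∀ j ≤ w.length, G.dist x (w.getVert j) = j := by
      intro j hj
      have h₁ := SimpleGraph.dist_le (w.take j)
      have h₂ := SimpleGraph.dist_le (w.drop j)
      have h₃ := hconn.dist_triangle (u := x) (v := w.getVert j) (w := y)
      simp only [SimpleGraph.Walk.take_length, SimpleGraph.Walk.drop_length] at h₁ h₂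
      lia
    exact ⟨w.getVert i, (hP _).2 (hd _ (by lia)), w.getVert (i + 1), (hQ _).2 (hd _ (by lia)),
      w.adj_getVert_succ (by lia)⟩
  obtain ⟨z, hpz, hqz⟩ := hG.exists_common_neighbor hn hpq
  have h₁ := hPb _ _ hpz
  have h₂ := hQb _ _ hqz
  -- Being adjacent to both `p` and `q`, the vertex `z` lies in one of their two levels.
  rcases le_or_gt (G.dist x z) i with hz | hz
  · have : z ∈ P := by
      have := hlip _ _ hqz.symm
      rw [hQ] at hq
      rw [hP]; lia
    have := h₁.2 hp this
    lia
  · have : z ∈ Q := by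
      have := hlip _ _ hpz
      rw [hP] at hp
      rw [hQ]; lia
    have := h₂.2 hq this
    lia

theorem EdgePancyclic.five_mul_dist_le {V : Type*} [Fintype V] {G : SimpleGraph V}
    (hG : EdgePancyclic G) (hn : 3 ≤ Fintype.card V) (hconn : G.Connected) {x y : V}
    (hmax : ∀ v, G.dist x v ≤ G.dist x y) : 5 * G.dist x y ≤ 2 * Fintype.card V := by
  classical
  rcases lt_or_ge (G.dist x y) 2 with hD | hD
  · lia
  obtain ⟨m, hm⟩ := Nat.exists_eq_add_of_le' hD
  let L : ℕ → Finset V := fun i ↦ Finset.univ.filter fun v ↦ G.dist x v = i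
  have hL : ∀ i v, v ∈ L i ↔ G.dist x v = i := by simp [L]
  have hdisj : ∀ i j, i ≠ j → Disjoint (L i) (L j) := by
    intro i j hij
    refine Finset.disjoint_left.2 fun v hv hv' ↦ hij ?_
    rw [← (hL i v).1 hv, ← (hL j v).1 hv']
  have htotal : ∑ i ∈ Finset.range (m + 3), (L i).card ≤ Fintype.card V := by
    rw [← Finset.card_biUnion fun i _ j _ hij ↦ hdisj i j hij]
    exact Finset.card_le_univ _
  have hlip : ∀ u v, G.Adj u v → G.dist x v ≤ G.dist x u + 1 := by
    intro u v huv
    have := hconn.dist_triangle (u := x) (v := u) (w := v)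
    rwa [SimpleGraph.dist_eq_one_iff_adj.2 huv] at this
  have hxy : x ≠ y := by rintro rfl; simp at hm
  have hnadj : ¬ G.Adj x y := fun h ↦ by
    rw [SimpleGraph.dist_eq_one_iff_adj.2 h] at hm; lia
  have hdeg : ∀ u v, u ≠ v → ¬ G.Adj u v → 3 ≤ (Finset.univ.filter (G.Adj u)).card := by
    intro u v huv hadj
    have : Nontrivial V := ⟨u, v, huv⟩
    obtain ⟨w, hw⟩ := hconn.preconnected.exists_adj_of_nontrivial u
    exact hG.three_le_card_neighbors hn (by simp) ⟨w, by simpa using hw⟩ huv.symm hadj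
  have h0 : (L 0).card = 1 := by
    rw [Finset.card_eq_one]
    refine ⟨x, Finset.ext fun v ↦ ?_⟩
    rw [hL, hconn.dist_eq_zero_iff, Finset.mem_singleton, eq_comm]
  have h1 : 3 ≤ (L 1).card := by
    refine (hdeg x y hxy hnadj).trans (Finset.card_le_card fun v hv ↦ ?_)
    rw [hL, SimpleGraph.dist_eq_one_iff_adj]
    simpa using hv
  have hlast : 1 ≤ (L (m + 2)).card := Finset.card_pos.2 ⟨y, (hL _ _).2 hm⟩
  -- As `y` is farthest from `x`, its closed neighbourhood lies in the last two levels.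
  have hlast' : 4 ≤ (L (m + 1)).card + (L (m + 2)).card := by
    rw [← Finset.card_union_of_disjoint (hdisj _ _ (by lia))]
    have hy : y ∉ Finset.univ.filter (G.Adj y) := by simp
    have := hdeg y x hxy.symm fun h ↦ hnadj h.symm
    have hcard := Finset.card_insert_of_notMem hy
    refine le_trans (by rw [hcard]; lia)
      (Finset.card_le_card (s := insert y (Finset.univ.filter (G.Adj y))) fun v hv ↦ ?_)
    rw [Finset.mem_union, hL, hL]
    rcases Finset.mem_insert.1 hv with rfl | hv
    · exact Or.inr hm
    · have hadj : G.Adj y v := by simpa using hv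
      have := hlip _ _ hadj.symm
      have := hmax v
      lia
  have hmid : ∀ i ∈ Finset.range m, 5 ≤ (L (i + 1)).card + (L (i + 1 + 1)).card := by
    intro i hi
    rw [Finset.mem_range] at hi
    exact hG.five_le_card_levels hn hconn (Nat.succ_pos i) (by lia : i + 1 + 1 < G.dist x y)
      (hL _) (hL _)
  have hsum := Finset.card_nsmul_le_sum _ _ _ hmid
  rw [Finset.card_range, smul_eq_mul, Finset.sum_add_distrib] at hsum
  -- Adding `e₁` and `e₂` bounds twice the order below by `5 * m + 2 + 3 + 4 + 1 = 5 * (m + 2)`.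
  have e₁ : ∑ i ∈ Finset.range (m + 3), (L i).card = ∑ i ∈ Finset.range m, (L (i + 1)).card
      + (L 0).card + (L (m + 1)).card + (L (m + 2)).card := by
    rw [Finset.sum_range_succ, Finset.sum_range_succ, Finset.sum_range_succ']
  have e₂ : ∑ i ∈ Finset.range (m + 3), (L i).card = ∑ i ∈ Finset.range m, (L (i + 1 + 1)).card
      + (L 0).card + (L 1).card + (L (m + 2)).card := by
    rw [Finset.sum_range_succ, Finset.sum_range_succ', Finset.sum_range_succ']
    lia
  lia

theorem EdgePancyclic.ediam_le {V : Type*} [Fintype V] {G : SimpleGraph V}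
    (hG : EdgePancyclic G) (hn : 3 ≤ Fintype.card V) (hne : G.edgeSet.Nonempty) :
    G.ediam ≤ (2 * Fintype.card V / 5 : ℕ) := by
  obtain ⟨e, he⟩ := hne
  induction e with | _ a b =>
  have hconn := hG.connected hn he
  have : Nonempty V := ⟨a⟩
  obtain ⟨x, y, hxy⟩ := G.exists_edist_eq_ediam_of_finite
  have hdist : ∀ u v, (G.dist u v : ℕ∞) = G.edist u v := fun u v ↦ (hconn u v).coe_dist_eq_edist
  have hmax : ∀ v, G.dist x v ≤ G.dist x y := by
    intro v
    have : G.edist x v ≤ G.edist x y := hxy ▸ G.edist_le_ediam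
    rw [← hdist, ← hdist] at this
    exact_mod_cast this
  have := hG.five_mul_dist_le hn hconn hmax
  rw [← hxy, ← hdist]
  exact_mod_cast (by lia : G.dist x y ≤ 2 * Fintype.card V / 5)

/-! ### Cycles through an edge, and blocks. -/

namespace SimpleGraph

/-- The list `u :: v :: l` runs once around a cycle of `G` that starts with the edge `uv`. A closed
walk `u, v, u` along an edge is allowed. -/
def EdgeCycle {V : Type*} (G : SimpleGraph V) (u v : V) (l : List V) : Prop :=
  (u :: v :: l).Nodup ∧ (u :: v :: l ++ [u]).IsChain G.Adj

theorem EdgeCycle.map {V W : Type*} {G : SimpleGraph V} {H : SimpleGraph W} (φ : V → W)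
    (hφ : Function.Injective φ) (hadj : ∀ a b, G.Adj a b → H.Adj (φ a) (φ b)) {u v : V}
    {l : List V} (h : G.EdgeCycle u v l) : H.EdgeCycle (φ u) (φ v) (l.map φ) := by
  refine ⟨by simpa using h.1.map hφ, ?_⟩
  simpa using List.isChain_map_of_isChain φ hadj h.2

theorem EdgeCycle.exists_isCycle {V : Type*} {G : SimpleGraph V} {u v : V} {l : List V}
    (h : G.EdgeCycle u v l) (hl : l ≠ []) :
    ∃ (w : V) (c : G.Walk w w), c.IsCycle ∧ c.length = l.length + 2 ∧ s(u, v) ∈ c.edges := by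
  obtain ⟨hnodup, hchain⟩ := h
  have huv : G.Adj u v := hchain.rel
  have hne : v :: l ++ [u] ≠ [] := by simp
  have hchain' : (v :: l ++ [u]).IsChain G.Adj := hchain.of_cons
  obtain ⟨p, hp⟩ : ∃ p : G.Walk v u, p.support = v :: l ++ [u] := by
    have : ∀ (L : List V) (hL : L ≠ []), L.IsChain G.Adj → L.head hL = v → L.getLast hL = u →
        ∃ p : G.Walk v u, p.support = L := by
      rintro L hL hc rfl rfl
      exact ⟨Walk.ofSupport L hL hc, Walk.support_ofSupport hL hc⟩
    exact this _ hne hchain' (by simp) (by simp)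
  have hlen : p.length = l.length + 1 := by
    have := p.length_support
    rw [hp] at this
    simpa using this.symm
  have hpath : p.IsPath := by
    rw [Walk.isPath_def, hp]
    simpa using (List.perm_append_singleton u (v :: l)).nodup_iff.2 hnodup
  refine ⟨u, .cons huv p, (Walk.cons_isCycle_iff _ _).2 ⟨hpath, fun he ↦ hl ?_⟩, by simp [hlen],
    by simp⟩
  -- A path from `v` to `u` that uses the edge `uv` has length one, which forces `l` to be empty.
  rw [← Walk.mem_edges_toSubgraph, Subgraph.mem_edgeSet, Walk.toSubgraph_adj_iff] at he
  obtain ⟨i, hi, hil⟩ := he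
  have hinj : ∀ i j, i ≤ p.length → j ≤ p.length → p.getVert i = p.getVert j → i = j :=
    fun i j hi hj h ↦ hpath.getVert_injOn hi hj h
  rw [List.eq_nil_iff_length_eq_zero]
  rcases Sym2.eq_iff.1 hi with ⟨h₁, h₂⟩ | ⟨h₁, h₂⟩
  · have := hinj i p.length hil.le le_rfl (by simpa using h₁)
    lia
  · have h₃ := hinj i 0 hil.le (by lia) (by simpa using h₁)
    have := hinj (i + 1) p.length hil le_rfl (by simpa using h₂)
    lia

/-- The edge `uv` lies on cycles of all lengths, and on a cycle missing just one vertex that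
passes through `x`, as well as one that passes through `y`. -/
structure FlexibleEdge {V : Type*} [Fintype V] (G : SimpleGraph V) (x y u v : V) : Prop where
  cycle : ∀ k, 3 ≤ k → k ≤ Fintype.card V → ∃ l, G.EdgeCycle u v l ∧ l.length + 2 = k
  left : ∃ l, G.EdgeCycle u v l ∧ l.length + 3 = Fintype.card V ∧ x ∈ u :: v :: l
  right : ∃ l, G.EdgeCycle u v l ∧ l.length + 3 = Fintype.card V ∧ y ∈ u :: v :: l

theorem FlexibleEdge.comm {V : Type*} [Fintype V] {G : SimpleGraph V} {x y u v : V}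
    (h : G.FlexibleEdge x y u v) : G.FlexibleEdge y x u v :=
  ⟨h.cycle, h.right, h.left⟩

theorem FlexibleEdge.map {V W : Type*} [Fintype V] [Fintype W] {G : SimpleGraph V}
    {H : SimpleGraph W} (φ : G ≃g H) {x y u v : V} (h : G.FlexibleEdge x y u v) :
    H.FlexibleEdge (φ x) (φ y) (φ u) (φ v) := by
  have hcard : Fintype.card V = Fintype.card W := Fintype.card_congr φ.toEquiv
  have hmap : ∀ l, G.EdgeCycle u v l → H.EdgeCycle (φ u) (φ v) (l.map φ) := fun l hl ↦
    hl.map φ φ.injective fun _ _ ↦ φ.map_adj_iff.2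
  refine ⟨fun k h₁ h₂ ↦ ?_, ?_, ?_⟩
  · obtain ⟨l, hl, rfl⟩ := h.cycle k h₁ (hcard ▸ h₂)
    exact ⟨_, hmap l hl, by simp⟩
  · obtain ⟨l, hl, hlen, hx⟩ := h.left
    exact ⟨_, hmap l hl, by simpa [← hcard], by simpa using List.mem_map_of_mem (f := φ) hx⟩
  · obtain ⟨l, hl, hlen, hx⟩ := h.right
    exact ⟨_, hmap l hl, by simpa [← hcard], by simpa using List.mem_map_of_mem (f := φ) hx⟩

/-- A graph with two ends `x` and `y`, at distance at least `D`, all of whose edges are flexible. -/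
structure IsBlock {V : Type*} [Fintype V] (G : SimpleGraph V) (x y : V) (D : ℕ) : Prop where
  three_le : 3 ≤ Fintype.card V
  ne : x ≠ y
  adj_left : ∃ w, G.Adj x w
  adj_right : ∃ w, G.Adj y w
  flexible : ∀ u v, G.Adj u v → G.FlexibleEdge x y u v
  potential : ∃ h : V → ℕ, (∀ u v, G.Adj u v → h v ≤ h u + 1) ∧ h x = 0 ∧ h y = D

theorem IsBlock.comm {V : Type*} [Fintype V] {G : SimpleGraph V} {x y : V} {D : ℕ}
    (h : G.IsBlock x y D) : G.IsBlock y x D := by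
  obtain ⟨f, hf, hx, hy⟩ := h.potential
  refine ⟨h.three_le, h.ne.symm, h.adj_right, h.adj_left, fun u v huv ↦ (h.flexible u v huv).comm,
    fun z ↦ D - f z, fun u v huv ↦ ?_, by simp [hy], by simp [hx]⟩
  have := hf v u huv.symm
  lia

/-! ### Gluing two blocks along twin ends. -/

section Glue

variable {V₁ V₂ : Type*} (G₁ : SimpleGraph V₁) (d : V₁) (G₂ : SimpleGraph V₂) (e : V₂)

/-- The graph obtained from the disjoint union of `G₁` and `G₂` by joining `d` to the neighbours
of `e` and `e` to the neighbours of `d`. -/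
def glue : SimpleGraph (V₁ ⊕ V₂) where
  Adj
    | .inl u, .inl v => G₁.Adj u v
    | .inr u, .inr v => G₂.Adj u v
    | .inl u, .inr w => (u = d ∧ G₂.Adj e w) ∨ (w = e ∧ G₁.Adj d u)
    | .inr w, .inl u => (u = d ∧ G₂.Adj e w) ∨ (w = e ∧ G₁.Adj d u)
  symm := ⟨by rintro (u | u) (v | v) h <;> first | exact h.symm | exact h⟩
  loopless := ⟨by rintro (u | u) h <;> exact h.ne rfl⟩

@[simp] theorem glue_inl_inl {u v : V₁} : (glue G₁ d G₂ e).Adj (.inl u) (.inl v) ↔ G₁.Adj u v :=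
  Iff.rfl

@[simp] theorem glue_inr_inr {u v : V₂} : (glue G₁ d G₂ e).Adj (.inr u) (.inr v) ↔ G₂.Adj u v :=
  Iff.rfl

@[simp] theorem glue_inl_inr {u : V₁} {w : V₂} : (glue G₁ d G₂ e).Adj (.inl u) (.inr w) ↔
    (u = d ∧ G₂.Adj e w) ∨ (w = e ∧ G₁.Adj d u) :=
  Iff.rfl

@[simp] theorem glue_inr_inl {u : V₁} {w : V₂} : (glue G₁ d G₂ e).Adj (.inr w) (.inl u) ↔
    (u = d ∧ G₂.Adj e w) ∨ (w = e ∧ G₁.Adj d u) :=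
  Iff.rfl

/-- Gluing is symmetric in the two graphs. -/
def glueComm : glue G₁ d G₂ e ≃g glue G₂ e G₁ d where
  toEquiv := Equiv.sumComm V₁ V₂
  map_rel_iff' := by rintro (u | u) (v | v) <;> simp [or_comm]

/-- Twins are interchangeable in any chain, which lets a cycle arrive at one twin and depart from
the other. -/
theorem glue_twin (z : V₁ ⊕ V₂) :
    (glue G₁ d G₂ e).Adj (.inl d) z ↔ (glue G₁ d G₂ e).Adj (.inr e) z := by
  rcases z with z | z <;> simp

variable {G₁ d G₂ e}

theorem glue_isChain_last {X : List (V₁ ⊕ V₂)} :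
    (X ++ [Sum.inl d]).IsChain (SimpleGraph.glue G₁ d G₂ e).Adj ↔
      (X ++ [Sum.inr e]).IsChain (SimpleGraph.glue G₁ d G₂ e).Adj := by
  have h : ∀ z, (SimpleGraph.glue G₁ d G₂ e).Adj z (Sum.inl d) ↔
      (SimpleGraph.glue G₁ d G₂ e).Adj z (Sum.inr e) := fun z ↦ by
    rw [adj_comm, glue_twin, adj_comm]
  simp [List.isChain_append, h]

theorem glue_isChain_head {X : List (V₁ ⊕ V₂)} :
    (Sum.inl d :: X).IsChain (SimpleGraph.glue G₁ d G₂ e).Adj ↔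
      (Sum.inr e :: X).IsChain (SimpleGraph.glue G₁ d G₂ e).Adj := by
  simp [List.isChain_cons, glue_twin]

/-- The single visit to `d` is opened into a detour through `M` between the two twins, in either
order. -/
theorem glue_isChain {A B : List V₁} {M : List V₂} (h₁ : (A ++ d :: B).IsChain G₁.Adj)
    (h₂ : (e :: M ++ [e]).IsChain G₂.Adj) :
    (A.map Sum.inl ++ Sum.inl d :: (M.map Sum.inr ++ Sum.inr e :: B.map Sum.inl)).IsChain (SimpleGraph.glue G₁ d G₂ e).Adj ∧
    (A.map Sum.inl ++ Sum.inr e :: (M.map Sum.inr ++ Sum.inl d :: B.map Sum.inl)).IsChain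
      (SimpleGraph.glue G₁ d G₂ e).Adj := by
  have h₁' := List.isChain_map_of_isChain (S := (SimpleGraph.glue G₁ d G₂ e).Adj) Sum.inl (fun _ _ h ↦ h) h₁
  have h₂' := List.isChain_map_of_isChain (S := (SimpleGraph.glue G₁ d G₂ e).Adj) Sum.inr (fun _ _ h ↦ h) h₂
  simp only [List.map_append, List.map_cons, List.cons_append, List.map_nil] at h₁' h₂'
  rw [List.isChain_split] at h₁'
  have h₃ : (Sum.inl d :: (M.map Sum.inr ++ [Sum.inr e])).IsChain (SimpleGraph.glue G₁ d G₂ e).Adj :=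
    glue_isChain_head.2 h₂'
  have h₄ : (Sum.inr e :: (M.map Sum.inr ++ [Sum.inl d])).IsChain (SimpleGraph.glue G₁ d G₂ e).Adj := by
    rw [← List.cons_append, glue_isChain_last]
    exact h₂'
  constructor
  · refine List.isChain_split.2 ⟨h₁'.1, ?_⟩
    rw [← List.cons_append]
    exact List.isChain_split.2 ⟨h₃, glue_isChain_head.1 h₁'.2⟩
  · refine List.isChain_split.2 ⟨glue_isChain_last.1 h₁'.1, ?_⟩
    rw [← List.cons_append]
    exact List.isChain_split.2 ⟨h₄, h₁'.2⟩

/-- A cycle of `G₁` through `d` and a cycle of `G₂` through `e` combine. -/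
theorem EdgeCycle.glue {u v : V₁} {l : List V₁} {w : V₂} {m : List V₂}
    (h₁ : G₁.EdgeCycle u v l) (hd : d ∈ u :: v :: l) (h₂ : G₂.EdgeCycle e w m) :
    ∃ l', (SimpleGraph.glue G₁ d G₂ e).EdgeCycle (Sum.inl u) (Sum.inl v) l' ∧
      l'.length = l.length + (m.length + 2) ∧
      (∀ z ∈ u :: v :: l, Sum.inl z ∈ Sum.inl u :: Sum.inl v :: l') ∧
      ∀ z ∈ e :: w :: m, Sum.inr z ∈ Sum.inl u :: Sum.inl v :: l' := by
  have hnodup : ∀ l' : List (V₁ ⊕ V₂),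
      l'.Perm ((u :: v :: l).map Sum.inl ++ (e :: w :: m).map Sum.inr) → l'.Nodup := by
    intro l' hl'
    rw [hl'.nodup_iff, List.nodup_append]
    refine ⟨h₁.1.map Sum.inl_injective, h₂.1.map Sum.inr_injective, ?_⟩
    simp only [List.mem_map]
    rintro _ ⟨_, -, rfl⟩ _ ⟨_, -, rfl⟩
    simp
  suffices ∃ l', (Sum.inl u :: Sum.inl v :: l' ++ [Sum.inl u]).IsChain
        (SimpleGraph.glue G₁ d G₂ e).Adj ∧
      (Sum.inl u :: Sum.inl v :: l').Perm ((u :: v :: l).map Sum.inl ++ (e :: w :: m).map Sum.inr) by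
    obtain ⟨l', hchain, hperm⟩ := this
    refine ⟨l', ⟨hnodup _ hperm, hchain⟩, ?_, fun z hz ↦ ?_, fun z hz ↦ ?_⟩
    · have := hperm.length_eq
      simp at this
      lia
    · rw [hperm.mem_iff, List.mem_append]
      exact Or.inl (List.mem_map_of_mem hz)
    · rw [hperm.mem_iff, List.mem_append]
      exact Or.inr (List.mem_map_of_mem hz)
  -- The edge `uv` has to survive: if `d = u`, the detour is placed at the closing visit to `u`;
  -- otherwise it starts right after `d`.
  rcases List.mem_cons.1 hd with rfl | hd
  · refine ⟨l.map Sum.inl ++ (e :: w :: m).map Sum.inr, ?_, by simp⟩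
    simpa using (glue_isChain (A := d :: v :: l) (B := []) h₁.2 h₂.2).2
  · obtain ⟨s, t, hst⟩ := List.append_of_mem hd
    have h₁' := h₁.2
    rw [hst, List.cons_append, List.append_assoc, List.cons_append, ← List.cons_append] at h₁'
    have key := (glue_isChain h₁' h₂.2).1
    have hp : ((s ++ d :: t).map Sum.inl ++ (e :: w :: m).map Sum.inr).Perm
        (s.map Sum.inl ++ Sum.inl d :: ((w :: m).map Sum.inr ++ Sum.inr e :: t.map Sum.inl)) := by
      simp only [List.map_append, List.map_cons, List.append_assoc, List.cons_append]
      have := (List.perm_append_comm (l₁ := t.map Sum.inl)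
        (l₂ := Sum.inr e :: Sum.inr w :: m.map Sum.inr)).trans
        (List.perm_middle (l₁ := Sum.inr w :: m.map Sum.inr)).symm
      exact (this.cons _).append_left _
    rcases s with _ | ⟨v', s⟩
    · obtain ⟨rfl, rfl⟩ : v = d ∧ l = t := by simpa using hst
      exact ⟨(w :: m).map Sum.inr ++ Sum.inr e :: l.map Sum.inl, by simpa using key,
        by simpa using hp.symm⟩
    · obtain ⟨rfl, rfl⟩ : v = v' ∧ l = s ++ d :: t := by simpa using hst
      exact ⟨s.map Sum.inl ++ Sum.inl d :: ((w :: m).map Sum.inr ++ Sum.inr e :: t.map Sum.inl),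
        by simpa using key, by simpa using hp.symm⟩

end Glue

section Glue

variable {V₁ V₂ : Type*} [Fintype V₁] [Fintype V₂]

/-- With `n₁` the order of `G₁`, lengths up to `n₁` come from `G₁` alone. Length `n₁ + 1` is `(n₁ -
1) + 2`, which is why blocks need a cycle through `d` missing one vertex; here the 2 is the closed
walk `e, w, e`. Length `n₁ + 2` uses that walk with a Hamiltonian cycle, and larger lengths use a
genuine cycle of `G₂`. -/
theorem FlexibleEdge.glue {G₁ : SimpleGraph V₁} {x d : V₁} {D₁ : ℕ} {G₂ : SimpleGraph V₂}
    {e y : V₂} {D₂ : ℕ} (h₁ : G₁.IsBlock x d D₁) (h₂ : G₂.IsBlock e y D₂) {u v : V₁}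
    (huv : G₁.Adj u v) :
    (glue G₁ d G₂ e).FlexibleEdge (.inl x) (.inr y) (.inl u) (.inl v) := by
  obtain ⟨w, hew⟩ := h₂.adj_left
  have hf₁ := h₁.flexible u v huv
  have hf₂ := h₂.flexible e w hew
  have three₁ := h₁.three_le
  have three₂ := h₂.three_le
  have hcard : Fintype.card (V₁ ⊕ V₂) = Fintype.card V₁ + Fintype.card V₂ := Fintype.card_sum
  obtain ⟨l, hl, hllen⟩ := hf₁.cycle _ three₁ le_rfl
  obtain ⟨m, hm, hmlen⟩ := hf₂.cycle _ three₂ le_rfl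
  have hl_mem : ∀ z, z ∈ u :: v :: l := by
    classical
    have h := Finset.eq_univ_of_card (u :: v :: l).toFinset (by
      rw [List.toFinset_card_of_nodup hl.1]; simpa using hllen)
    intro z
    rw [← List.mem_toFinset, h]
    exact Finset.mem_univ z
  have hm_mem : ∀ z, z ∈ e :: w :: m := by
    classical
    have h := Finset.eq_univ_of_card (e :: w :: m).toFinset (by
      rw [List.toFinset_card_of_nodup hm.1]; simpa using hmlen)
    intro z
    rw [← List.mem_toFinset, h]
    exact Finset.mem_univ z
  obtain ⟨l', hl', hl'len, hl'd⟩ := hf₁.right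
  obtain ⟨m', hm', hm'len, hm'y⟩ := hf₂.left
  have hnil : G₂.EdgeCycle e w [] := ⟨by simpa using hew.ne, by simpa using ⟨hew, hew.symm⟩⟩
  refine ⟨fun k hk hkle ↦ ?_, ?_, ?_⟩
  · rw [hcard] at hkle
    rcases le_or_gt k (Fintype.card V₁) with hk₁ | hk₁
    · obtain ⟨s, hs, rfl⟩ := hf₁.cycle k hk hk₁
      exact ⟨s.map .inl, hs.map _ Sum.inl_injective fun _ _ h ↦ h, by simp⟩
    obtain ⟨j, rfl⟩ := Nat.exists_eq_add_of_lt hk₁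
    rcases j with _ | _ | j
    · obtain ⟨s, hs, hlen, -⟩ := hl'.glue hl'd hnil
      exact ⟨s, hs, by simp at hlen; lia⟩
    · obtain ⟨s, hs, hlen, -⟩ := hl.glue (hl_mem d) hnil
      exact ⟨s, hs, by simp at hlen; lia⟩
    · obtain ⟨t, ht, htlen⟩ := hf₂.cycle (j + 3) (by lia) (by lia)
      obtain ⟨s, hs, hlen, -⟩ := hl.glue (hl_mem d) ht
      exact ⟨s, hs, by lia⟩
  · obtain ⟨s, hs, hlen, hmem, -⟩ := hl.glue (hl_mem d) hm'
    exact ⟨s, hs, by lia, hmem _ (hl_mem x)⟩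
  · obtain ⟨s, hs, hlen, -, hmem⟩ := hl'.glue hl'd hm
    exact ⟨s, hs, by lia, hmem _ (hm_mem y)⟩

/-- The automorphism of a glued graph that exchanges the twins `d` and `e`. -/
noncomputable def glueSwap [DecidableEq V₁] [DecidableEq V₂] (G₁ : SimpleGraph V₁) (d : V₁)
    (G₂ : SimpleGraph V₂) (e : V₂) : glue G₁ d G₂ e ≃g glue G₁ d G₂ e where
  toEquiv := Equiv.swap (.inl d) (.inr e)
  map_rel_iff' := by
    have h : ∀ a b, (glue G₁ d G₂ e).Adj (Equiv.swap (.inl d) (.inr e) a) b ↔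
        (glue G₁ d G₂ e).Adj a b := by
      intro a b
      rcases eq_or_ne a (.inl d) with rfl | ha
      · rw [Equiv.swap_apply_left, glue_twin]
      rcases eq_or_ne a (.inr e) with rfl | ha'
      · rw [Equiv.swap_apply_right, glue_twin]
      rw [Equiv.swap_apply_of_ne_of_ne ha ha']
    intro a b
    rw [h, adj_comm, h, adj_comm]

/-- Edges inside `G₂` follow from those inside `G₁` by symmetry. An edge between the two sides is
the image of an inner edge under the twin swap, which fixes `x` and `y`. -/
theorem IsBlock.glue {G₁ : SimpleGraph V₁} {x d : V₁} {D₁ : ℕ} {G₂ : SimpleGraph V₂}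
    {e y : V₂} {D₂ : ℕ} (h₁ : G₁.IsBlock x d D₁) (h₂ : G₂.IsBlock e y D₂) :
    (glue G₁ d G₂ e).IsBlock (.inl x) (.inr y) (D₁ + D₂) := by
  classical
  have hl : ∀ u v, G₁.Adj u v →
      (SimpleGraph.glue G₁ d G₂ e).FlexibleEdge (.inl x) (.inr y) (.inl u) (.inl v) :=
    fun u v huv ↦ FlexibleEdge.glue h₁ h₂ huv
  have hr : ∀ u v, G₂.Adj u v →
      (SimpleGraph.glue G₁ d G₂ e).FlexibleEdge (.inl x) (.inr y) (.inr u) (.inr v) :=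
    fun u v huv ↦ ((FlexibleEdge.glue h₂.comm h₁.comm huv).map (glueComm G₂ e G₁ d)).comm
  have hswap : ∀ a b, (SimpleGraph.glue G₁ d G₂ e).FlexibleEdge (.inl x) (.inr y) a b →
      (SimpleGraph.glue G₁ d G₂ e).FlexibleEdge (.inl x) (.inr y)
        (Equiv.swap (.inl d) (.inr e) a) (Equiv.swap (.inl d) (.inr e) b) := by
    intro a b h
    have h' := h.map (glueSwap G₁ d G₂ e)
    have hx : Equiv.swap (Sum.inl d) (Sum.inr e) (Sum.inl x) = Sum.inl x :=
      Equiv.swap_apply_of_ne_of_ne (by simpa using h₁.ne) (by simp)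
    have hy : Equiv.swap (Sum.inl d) (Sum.inr e) (Sum.inr y) = Sum.inr y :=
      Equiv.swap_apply_of_ne_of_ne (by simp) (by simpa using h₂.ne.symm)
    have happ : ∀ z, glueSwap G₁ d G₂ e z = Equiv.swap (.inl d) (.inr e) z := fun _ ↦ rfl
    simpa only [happ, hx, hy] using h'
  have hlr : ∀ u w, (SimpleGraph.glue G₁ d G₂ e).Adj (.inl u) (.inr w) →
      (SimpleGraph.glue G₁ d G₂ e).FlexibleEdge (.inl x) (.inr y) (.inl u) (.inr w) ∧
      (SimpleGraph.glue G₁ d G₂ e).FlexibleEdge (.inl x) (.inr y) (.inr w) (.inl u) := by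
    rintro u w (⟨rfl, hw⟩ | ⟨rfl, hu⟩)
    · have hne : Equiv.swap (Sum.inl u) (Sum.inr e) (Sum.inr w) = Sum.inr w :=
        Equiv.swap_apply_of_ne_of_ne (by simp) (by simpa using hw.ne.symm)
      have h := hswap _ _ (hr _ _ hw)
      have h' := hswap _ _ (hr _ _ hw.symm)
      rw [Equiv.swap_apply_right, hne] at h h'
      exact ⟨h, h'⟩
    · have hne : Equiv.swap (Sum.inl d) (Sum.inr w) (Sum.inl u) = Sum.inl u :=
        Equiv.swap_apply_of_ne_of_ne (by simpa using hu.ne.symm) (by simp)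
      have h := hswap _ _ (hl _ _ hu)
      have h' := hswap _ _ (hl _ _ hu.symm)
      rw [Equiv.swap_apply_left, hne] at h h'
      exact ⟨h', h⟩
  refine ⟨?_, by simp, ?_, ?_, ?_, ?_⟩
  · have := h₁.three_le
    rw [Fintype.card_sum]; lia
  · obtain ⟨w, hw⟩ := h₁.adj_left
    exact ⟨.inl w, hw⟩
  · obtain ⟨w, hw⟩ := h₂.adj_right
    exact ⟨.inr w, hw⟩
  · rintro (u | u) (v | v) h
    · exact hl u v h
    · exact (hlr u v h).1
    · exact (hlr v u h.symm).2
    · exact hr u v h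
  · obtain ⟨f, hf, hfx, hfd⟩ := h₁.potential
    obtain ⟨g, hg, hge, hgy⟩ := h₂.potential
    -- Both twins receive the value `D₁`, so the potentials fit together.
    refine ⟨Sum.elim f (fun z ↦ D₁ + g z), ?_, by simpa, by simpa⟩
    rintro (u | u) (v | v) h
    · exact hf u v h
    · rcases h with ⟨rfl, hv⟩ | ⟨rfl, hu⟩
      · have := hg _ _ hv
        simp only [Sum.elim_inl, Sum.elim_inr]; lia
      · have := hf _ _ hu
        have := hf _ _ hu.symm
        simp only [Sum.elim_inl, Sum.elim_inr]; lia
    · rcases h with ⟨rfl, hv⟩ | ⟨rfl, hu⟩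
      · have := hg _ _ hv
        have := hg _ _ hv.symm
        simp only [Sum.elim_inl, Sum.elim_inr]; lia
      · have := hf _ _ hu
        simp only [Sum.elim_inl, Sum.elim_inr]; lia
    · have := hg _ _ h
      simp only [Sum.elim_inr]; lia

end Glue

/-! ### Small blocks by verified search. -/

/-- The graph on `Fin n` in which two distinct vertices are adjacent when their levels, given by
the list `h`, differ by at most one. -/
def levelGraph (h : List ℕ) (n : ℕ) : SimpleGraph (Fin n) where
  Adj u v := (u.val.beq v.val = false ∧ (h.getD u 0).ble (h.getD v 0 + 1) = true) ∧
    (h.getD v 0).ble (h.getD u 0 + 1) = true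
  symm := ⟨fun u v ⟨⟨h₁, h₂⟩, h₃⟩ ↦ ⟨⟨by
    rw [Bool.eq_false_iff, ne_eq, Nat.beq_eq] at h₁ ⊢; exact fun h ↦ h₁ h.symm, h₃⟩, h₂⟩⟩
  loopless := ⟨fun u h ↦ by simp at h⟩

instance (h : List ℕ) (n : ℕ) : DecidableRel (levelGraph h n).Adj :=
  fun _ _ ↦ inferInstanceAs (Decidable ((_ ∧ _) ∧ _))

/-- Search for a path that extends the path `b :: p` at the front by `k` vertices and satisfies
`goal`. -/
def searchPath {n : ℕ} (G : SimpleGraph (Fin n)) [DecidableRel G.Adj]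
    (goal : Fin n → List (Fin n) → Bool) : ℕ → Fin n → List (Fin n) → Bool
  | 0, b, p => goal b p
  | k + 1, b, p => (List.finRange n).any fun w ↦
      decide (G.Adj w b) && (!(b :: p).contains w && searchPath G goal k w (b :: p))

theorem exists_of_searchPath {n : ℕ} {G : SimpleGraph (Fin n)} [DecidableRel G.Adj]
    {goal : Fin n → List (Fin n) → Bool} {k : ℕ} {b : Fin n} {p : List (Fin n)}
    (h : searchPath G goal k b p = true) (hnodup : (b :: p).Nodup)
    (hchain : (b :: p).IsChain G.Adj) :
    ∃ c q s, c :: q = s ++ b :: p ∧ s.length = k ∧ goal c q = true ∧ (c :: q).Nodup ∧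
      (c :: q).IsChain G.Adj := by
  induction k generalizing b p with
  | zero => exact ⟨b, p, [], rfl, rfl, h, hnodup, hchain⟩
  | succ k ih =>
    obtain ⟨w, -, hw⟩ := List.any_eq_true.1 h
    simp only [Bool.and_eq_true, decide_eq_true_eq, Bool.not_eq_true', List.contains_eq_mem,
      decide_eq_false_iff_not] at hw
    obtain ⟨hwb, hmem, hs⟩ := hw
    obtain ⟨c, q, s, hcq, hlen, hrest⟩ := ih hs (List.nodup_cons.2 ⟨hmem, hnodup⟩)
      (List.isChain_cons_cons.2 ⟨hwb, hchain⟩)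
    exact ⟨c, q, s ++ [w], by simpa using hcq, by simpa using hlen, hrest⟩

/-- Search for a cycle of length `k + 2` through `z` and the edge `uv`. -/
def searchCycle {n : ℕ} (G : SimpleGraph (Fin n)) [DecidableRel G.Adj] (z u v : Fin n) (k : ℕ) :
    Bool :=
  searchPath G (fun c q ↦ decide (G.Adj u c) && (c :: q).contains z) k v [u]

theorem exists_edgeCycle_of_searchCycle {n : ℕ} {G : SimpleGraph (Fin n)} [DecidableRel G.Adj]
    {z u v : Fin n} {k : ℕ} (huv : G.Adj u v) (h : searchCycle G z u v k = true) :
    ∃ l, G.EdgeCycle u v l ∧ l.length = k ∧ z ∈ u :: v :: l := by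
  obtain ⟨c, q, s, hcq, hlen, hgoal, hnodup, hchain⟩ := exists_of_searchPath h
    (by simpa using huv.ne.symm) (by simpa using huv.symm)
  simp only [Bool.and_eq_true, decide_eq_true_eq, List.contains_eq_mem] at hgoal
  obtain ⟨huc, hz⟩ := hgoal
  have hrev : u :: v :: s.reverse = (c :: q).reverse := by simp [hcq]
  refine ⟨s.reverse, ⟨by rw [hrev]; exact List.nodup_reverse.2 hnodup, ?_⟩, by simpa, ?_⟩
  · rw [hrev, ← List.reverse_cons, List.isChain_reverse]
    exact (List.isChain_cons_cons.2 ⟨huc, hchain⟩).imp fun _ _ h ↦ h.symm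
  · rw [hrev, List.mem_reverse]
    exact hz

/-- The Boolean form of flexibility of all edges. -/
def checkFlexible {n : ℕ} (G : SimpleGraph (Fin n)) [DecidableRel G.Adj] (x y : Fin n) : Bool :=
  (List.finRange n).all fun u ↦ (List.finRange n).all fun v ↦ !decide (G.Adj u v) ||
    ((List.range (n - 2)).all (fun k ↦ searchCycle G u u v (k + 1)) &&
      (searchCycle G x u v (n - 3) && searchCycle G y u v (n - 3)))

theorem flexibleEdge_of_checkFlexible {n : ℕ} {G : SimpleGraph (Fin n)} [DecidableRel G.Adj]
    {x y : Fin n} (hn : 3 ≤ n) (h : checkFlexible G x y = true) {u v : Fin n} (huv : G.Adj u v) :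
    G.FlexibleEdge x y u v := by
  have h' := List.all_eq_true.1 (List.all_eq_true.1 h u (List.mem_finRange u)) v
    (List.mem_finRange v)
  simp only [huv, decide_true, Bool.not_true, Bool.false_or, Bool.and_eq_true,
    List.all_eq_true, List.mem_range] at h'
  obtain ⟨h₁, h₂, h₃⟩ := h'
  refine ⟨fun k hk hkn ↦ ?_, ?_, ?_⟩
  · rw [Fintype.card_fin] at hkn
    -- Index `k - 3` searches for `k - 2` vertices besides `u` and `v`; passing through `u` is no
    -- restriction.
    obtain ⟨l, hl, hlen, -⟩ := exists_edgeCycle_of_searchCycle huv (h₁ (k - 3) (by lia))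
    exact ⟨l, hl, by lia⟩
  · obtain ⟨l, hl, hlen, hz⟩ := exists_edgeCycle_of_searchCycle huv h₂
    exact ⟨l, hl, by rw [Fintype.card_fin]; lia, hz⟩
  · obtain ⟨l, hl, hlen, hz⟩ := exists_edgeCycle_of_searchCycle huv h₃
    exact ⟨l, hl, by rw [Fintype.card_fin]; lia, hz⟩

theorem isBlock_levelGraph {h : List ℕ} {n : ℕ} (hn : 3 ≤ n) {x y : Fin n}
    (hcheck : checkFlexible (levelGraph h n) x y = true) (hne : x ≠ y)
    (hx : ∃ w, (levelGraph h n).Adj x w) (hy : ∃ w, (levelGraph h n).Adj y w)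
    (hx0 : h.getD x 0 = 0) : (levelGraph h n).IsBlock x y (h.getD y 0) :=
  ⟨by simpa, hne, hx, hy, fun _ _ huv ↦ flexibleEdge_of_checkFlexible hn hcheck huv,
    fun v ↦ h.getD v 0, fun _ _ huv ↦ Nat.le_of_ble_eq_true huv.2, hx0, rfl⟩

theorem isBlock_four : (levelGraph [0, 1, 1, 1] 4).IsBlock 0 3 1 :=
  isBlock_levelGraph (by simp) (by decide +kernel) (by decide) (by decide) (by decide) rfl

theorem isBlock_five : (levelGraph [0, 1, 1, 1, 2] 5).IsBlock 0 4 2 :=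
  isBlock_levelGraph (by simp) (by decide +kernel) (by decide) (by decide) (by decide) rfl

theorem isBlock_six : (levelGraph [0, 1, 1, 1, 1, 2] 6).IsBlock 0 5 2 :=
  isBlock_levelGraph (by simp) (by decide +kernel) (by decide) (by decide) (by decide) rfl

theorem isBlock_seven : (levelGraph [0, 1, 1, 1, 1, 1, 2] 7).IsBlock 0 6 2 :=
  isBlock_levelGraph (by simp) (by decide +kernel) (by decide) (by decide) (by decide) rfl

theorem isBlock_eight : (levelGraph [0, 1, 1, 1, 2, 2, 2, 3] 8).IsBlock 0 7 3 :=
  isBlock_levelGraph (by simp) (by decide +kernel) (by decide) (by decide) (by decide) rfl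

/-! ### Extremal graphs of every order. -/

theorem exists_isBlock (n : ℕ) (hn : 4 ≤ n) :
    ∃ (V : Type) (_ : Fintype V) (G : SimpleGraph V) (x y : V),
      Fintype.card V = n ∧ G.IsBlock x y (2 * n / 5) := by
  induction n using Nat.strong_induction_on with | _ n ih =>
  rcases le_or_gt 9 n with h9 | h9
  · obtain ⟨V, _, G, x, y, hcard, hG⟩ := ih (n - 5) (by lia) (by lia)
    have hglue := hG.glue isBlock_five
    rw [show 2 * (n - 5) / 5 + 2 = 2 * n / 5 by lia] at hglue
    exact ⟨V ⊕ Fin 5, inferInstance, _, _, _, by rw [Fintype.card_sum, Fintype.card_fin]; lia, hglue⟩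
  · interval_cases n
    · exact ⟨_, _, _, _, _, Fintype.card_fin _, isBlock_four⟩
    · exact ⟨_, _, _, _, _, Fintype.card_fin _, isBlock_five⟩
    · exact ⟨_, _, _, _, _, Fintype.card_fin _, isBlock_six⟩
    · exact ⟨_, _, _, _, _, Fintype.card_fin _, isBlock_seven⟩
    · exact ⟨_, _, _, _, _, Fintype.card_fin _, isBlock_eight⟩

theorem le_edist_of_potential {V : Type*} {G : SimpleGraph V} {f : V → ℕ}
    (hf : ∀ u v, G.Adj u v → f v ≤ f u + 1) {x y : V} {D : ℕ} (hx : f x = 0) (hy : f y = D) :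
    (D : ℕ∞) ≤ G.edist x y := by
  refine le_iInf fun p ↦ ?_
  have : ∀ {u v : V} (p : G.Walk u v), f v ≤ f u + p.length := by
    intro u v p
    induction p with
    | nil => simp
    | cons h p ih =>
      have := hf _ _ h
      rw [Walk.length_cons]; lia
  have := this p
  exact_mod_cast (by lia : D ≤ p.length)

theorem edgePancyclic_of_edgeCycle {V : Type*} [Fintype V] {G : SimpleGraph V}
    (h : ∀ u v, G.Adj u v → ∀ k, 3 ≤ k → k ≤ Fintype.card V →
      ∃ l, G.EdgeCycle u v l ∧ l.length + 2 = k) : EdgePancyclic G := by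
  intro k hk hkn e he
  induction e with | _ u v =>
  obtain ⟨l, hl, rfl⟩ := h u v he k hk hkn
  exact hl.exists_isCycle (by rintro rfl; simp at hk)

/-- A block on `W` yields an edge-pancyclic graph on any type of the same cardinality. -/
theorem IsBlock.exists_edgePancyclic {V W : Type*} [Fintype V] [Fintype W] {H : SimpleGraph W}
    {x y : W} {D : ℕ} (h : H.IsBlock x y D) (φ : W ≃ V) :
    ∃ G : SimpleGraph V, G.edgeSet.Nonempty ∧ EdgePancyclic G ∧ (D : ℕ∞) ≤ G.ediam := by
  let G := H.comap φ.symm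
  have hcard := Fintype.card_congr φ
  obtain ⟨f, hf, hx, hy⟩ := h.potential
  refine ⟨G, ?_, edgePancyclic_of_edgeCycle fun u v huv k hk hkn ↦ ?_, ?_⟩
  · obtain ⟨w, hw⟩ := h.adj_left
    exact ⟨s(φ x, φ w), by simpa [G] using hw⟩
  · obtain ⟨l, hl, hlen⟩ := (h.flexible _ _ huv).cycle k hk (by rwa [hcard])
    have := hl.map (H := G) φ φ.injective (by simp [G])
    exact ⟨l.map φ, by simpa using this, by simpa using hlen⟩
  · exact (le_edist_of_potential (f := f ∘ φ.symm) (x := φ x) (y := φ y)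
      (fun u v huv ↦ hf _ _ huv) (by simpa) (by simpa)).trans G.edist_le_ediam

/-- Order three stands apart because a triangle is not a block: the closed walk along the edge
opposite `x` misses `x`. -/
theorem edgePancyclic_top_of_card_eq_three {V : Type*} [Fintype V] (h : Fintype.card V = 3) :
    EdgePancyclic (⊤ : SimpleGraph V) := by
  classical
  refine edgePancyclic_of_edgeCycle fun u v huv k hk hkn ↦ ?_
  obtain ⟨w, hw⟩ := Finset.exists_mem_notMem_of_card_lt_card (s := {u, v}) (t := Finset.univ)
    (by rw [Finset.card_univ, h]; exact Finset.card_le_two.trans_lt (by simp))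
  simp only [Finset.mem_univ, Finset.mem_insert, Finset.mem_singleton, not_or, true_and] at hw
  rw [top_adj] at huv
  refine ⟨[w], ⟨?_, ?_⟩, by simp; lia⟩
  · simp [huv, Ne.symm hw.1, Ne.symm hw.2]
  · simp [huv, Ne.symm hw.2, hw.1]

end SimpleGraph

theorem theorem6 {V : Type*} [Fintype V] (n : ℕ) (hV : Fintype.card V = n) (hn : 3 ≤ n) :
    IsGreatest
      {D : ℕ∞ | ∃ G : SimpleGraph V, G.edgeSet.Nonempty ∧ EdgePancyclic G ∧ G.ediam = D}
      ((⌊(2 * n : ℚ) / 5⌋₊ : ℕ) : ℕ∞) := by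
  have hfloor : ⌊(2 * n : ℚ) / 5⌋₊ = 2 * n / 5 := by
    exact_mod_cast Nat.floor_div_eq_div (K := ℚ) (2 * n) 5
  rw [hfloor]
  constructor
  · suffices ∃ G : SimpleGraph V, G.edgeSet.Nonempty ∧ EdgePancyclic G ∧
        ((2 * n / 5 : ℕ) : ℕ∞) ≤ G.ediam by
      obtain ⟨G, hne, hG, hD⟩ := this
      refine ⟨G, hne, hG, le_antisymm ?_ hD⟩
      subst hV
      exact hG.ediam_le hn hne
    rcases hn.eq_or_lt with rfl | hn
    · have : Nontrivial V := Fintype.one_lt_card_iff_nontrivial.1 (by lia)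
      obtain ⟨a, b, hab⟩ := exists_pair_ne V
      exact ⟨⊤, ⟨s(a, b), hab⟩, SimpleGraph.edgePancyclic_top_of_card_eq_three hV, by simp⟩
    · obtain ⟨W, _, H, x, y, hcard, hH⟩ := SimpleGraph.exists_isBlock n hn
      exact hH.exists_edgePancyclic (Fintype.equivOfCardEq (hcard.trans hV.symm))
  -- The diameter is extended, so this finite bound also contains connectedness.
  · rintro D ⟨G, hne, hG, rfl⟩
    subst hV
    exact hG.ediam_le hn hne
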